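/- Let $d\ge 0$ be an integer and let $\mathcal S^d$ be the space of real symmetric $d\times d$ matrices. Write $Q[x]=x^tQx$ for $Q\in\mathcal S^d$, $x\in\mathbb R^d$, and let $\mathsf{GL}_d(\mathbb Z)$ act on $\mathcal S^d$ by $Q\mapsto g^tQg$. The rational closure $\tilde{\mathcal S}^d_{\ge 0}$ is the set of all $Q\in\mathcal S^d$ for which there is a $U\in\mathsf{GL}_d(\mathbb Z)$ with $U^tQU=\begin{pmatrix}0&0\\0&Q'\end{pmatrix}$, where $Q'$ is a positive definite symmetric matrix of some size $d'$ with $0\le d'\le d$. For $Q\in\tilde{\mathcal S}^d_{\ge 0}$, a Delone polyhedron of $Q$ is a (possibly unbounded) set $P=\operatorname{conv}(V)$ with $\emptyset\ne V\subseteq\mathbb Z^d$ such that there are $c\in\mathbb R^d$ and $r\in\mathbb R$ with $Q[c-v]=r^2$ for all $v\in V$ and $Q[c-v]>r^2$ for all $v\in\mathbb Z^d\setminus V$. The set $\operatorname{Del}(Q)$ of all Delone polyhedra of $Q$ is the Delone subdivision of $Q$; a Delone subdivision of $\mathbb Z^d$ is a family of the form $\operatorname{Del}(Q)$ with $Q\in\tilde{\mathcal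 S}^d_{\ge 0}$. The secondary cone of a Delone subdivision $\mathcal D$ is $\mathbf\Delta(\mathcal D)=\{Q\in\tilde{\mathcal S}^d_{\ge 0}:\operatorname{Del}(Q)=\mathcal D\}$. For a linear subspace $T\subseteq\mathcal S^d$ the $T$-secondary cone of $\mathcal D$ is $\mathbf\Delta_T(\mathcal D)=\mathbf\Delta(\mathcal D)\cap T$. Two $T$-secondary cones $\Delta_T,\Delta_T'$ are $T$-equivalent if there is a $g\in\mathsf{GL}_d(\mathbb Z)$ with $g^t\Delta_Tg=\Delta_T'$ and $g^tTg=T$; otherwise they are $T$-inequivalent. Let $G$ be a finite subgroup of $\mathsf{GL}_d(\mathbb Z)$ and let $T=\mathcal F(G)=\{Q\in\mathcal S^d: g^tQg=Q\text{ for all }g\in G\}$ be its space of invariant forms. Then there are only finitely many $T$-inequivalent $T$-secondary cones of Delone subdivisions of $\mathbb Z^d$; that is, the set of $T$-equivalence classes of $T$-secondary cones is finite. -/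

import Mathlib

open scoped Matrix MatrixGroups

namespace Voronoi

variable {d : ℕ}

/-- The value `Q[x] = xᵗ Q x`. -/
def qval (Q : Matrix (Fin d) (Fin d) ℝ) (x : Fin d → ℝ) : ℝ :=
  x ⬝ᵥ (Q *ᵥ x)

/-- The integral matrix `g ∈ GL_d(ℤ)` as a real matrix. -/
def toReal (g : GL (Fin d) ℤ) : Matrix (Fin d) (Fin d) ℝ :=
  (g : Matrix (Fin d) (Fin d) ℤ).map (Int.cast : ℤ → ℝ)

/-- The action `Q ↦ gᵗ Q g` of `GL_d(ℤ)` on forms. -/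
def act (g : GL (Fin d) ℤ) (Q : Matrix (Fin d) (Fin d) ℝ) : Matrix (Fin d) (Fin d) ℝ :=
  (toReal g)ᵀ * Q * toReal g

/-- The rational closure of the cone of positive definite forms: all forms that are arithmetically
equivalent to a block matrix `diag(0, Q')` with `Q'` positive definite
(either block may have size `0`). -/
def rationalClosure (d : ℕ) : Set (Matrix (Fin d) (Fin d) ℝ) :=
  {Q | ∃ (U : GL (Fin d) ℤ) (m n : ℕ) (h : m + n = d) (Q' : Matrix (Fin n) (Fin n) ℝ),
    Q'.PosDef ∧
      act U Q = Matrix.reindex (finSumFinEquiv.trans (finCongr h))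
        (finSumFinEquiv.trans (finCongr h)) (Matrix.fromBlocks 0 0 0 Q')}

/-- The lattice `ℤ^d` as a subset of `ℝ^d`. -/
def latticePoints (d : ℕ) : Set (Fin d → ℝ) :=
  {v | ∃ z : Fin d → ℤ, ∀ i, v i = (z i : ℝ)}

/-- The points `v` of `ℤ^d` with `Q[c - v] = r²`. -/
def spherePoints (Q : Matrix (Fin d) (Fin d) ℝ) (c : Fin d → ℝ) (r : ℝ) : Set (Fin d → ℝ) :=
  {v | v ∈ latticePoints d ∧ qval Q (c - v) = r ^ 2}

/-- `P` is a (possibly unbounded, non-empty) Delone polyhedron of `Q` with vertex-set `ℤ^d`: the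
convex hull of the lattice points with `Q[c - v] = r²`, where all other lattice points
satisfy `Q[c - v] > r²`. -/
def IsDelonePolyhedron (Q : Matrix (Fin d) (Fin d) ℝ) (P : Set (Fin d → ℝ)) : Prop :=
  ∃ (c : Fin d → ℝ) (r : ℝ),
    (spherePoints Q c r).Nonempty ∧
    (∀ v ∈ latticePoints d, v ∉ spherePoints Q c r → r ^ 2 < qval Q (c - v)) ∧
    P = convexHull ℝ (spherePoints Q c r)

/-- The family of all Delone polyhedra (of all dimensions) of `Q`. -/
def Del (Q : Matrix (Fin d) (Fin d) ℝ) : Set (Set (Fin d → ℝ)) :=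
  {P | IsDelonePolyhedron Q P}

/-- `D` is a Delone subdivision with vertex-set `ℤ^d`. -/
def IsDeloneSubdivision (D : Set (Set (Fin d → ℝ))) : Prop :=
  ∃ Q ∈ rationalClosure d, Del Q = D

/-- The secondary cone of `D`. -/
def secondaryCone (D : Set (Set (Fin d → ℝ))) : Set (Matrix (Fin d) (Fin d) ℝ) :=
  {Q | Q ∈ rationalClosure d ∧ Del Q = D}

/-- The set of all `T`-secondary cones of Delone subdivisions of `ℤ^d`. -/
def tSecondaryCones (T : Submodule ℝ (Matrix (Fin d) (Fin d) ℝ)) :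
    Set (Set (Matrix (Fin d) (Fin d) ℝ)) :=
  {C | ∃ D, IsDeloneSubdivision D ∧ C = secondaryCone D ∩ T}

/-- `T`-equivalence: some `g ∈ GL_d(ℤ)` with `gᵗ T g = T` carries `C` to `C'`. -/
def TEquivalent (T : Submodule ℝ (Matrix (Fin d) (Fin d) ℝ))
    (C C' : Set (Matrix (Fin d) (Fin d) ℝ)) : Prop :=
  ∃ g : GL (Fin d) ℤ,
    act g '' C = C' ∧ act g '' (T : Set (Matrix (Fin d) (Fin d) ℝ)) = T

theorem toReal_one : toReal (1 : GL (Fin d) ℤ) = 1 := by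
  simp [toReal]

theorem toReal_mul (g h : GL (Fin d) ℤ) : toReal (g * h) = toReal g * toReal h := by
  simp only [toReal, Units.val_mul]
  exact Matrix.map_mul (f := Int.castRingHom ℝ)

theorem act_one (Q : Matrix (Fin d) (Fin d) ℝ) : act 1 Q = Q := by
  simp [act, toReal_one]

theorem act_mul (g h : GL (Fin d) ℤ) (Q : Matrix (Fin d) (Fin d) ℝ) :
    act (g * h) Q = act h (act g Q) := by
  simp only [act, toReal_mul, Matrix.transpose_mul, Matrix.mul_assoc]

theorem image_act_mul (g h : GL (Fin d) ℤ) (C : Set (Matrix (Fin d) (Fin d) ℝ)) :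
    act (g * h) '' C = act h '' (act g '' C) := by
  rw [Set.image_image]
  exact Set.image_congr fun Q _ => act_mul g h Q

theorem image_act_one (C : Set (Matrix (Fin d) (Fin d) ℝ)) : act 1 '' C = C := by
  rw [Set.image_congr fun Q _ => act_one Q, Set.image_id']

theorem image_act_inv (g : GL (Fin d) ℤ) {C C' : Set (Matrix (Fin d) (Fin d) ℝ)}
    (h : act g '' C = C') : act g⁻¹ '' C' = C := by
  rw [← h, ← image_act_mul, mul_inv_cancel, image_act_one]

theorem tEquivalent_equivalence (T : Submodule ℝ (Matrix (Fin d) (Fin d) ℝ)) :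
    Equivalence (TEquivalent T) where
  refl C := ⟨1, image_act_one C, image_act_one _⟩
  symm := fun ⟨g, h, hT⟩ => ⟨g⁻¹, image_act_inv g h, image_act_inv g hT⟩
  trans := fun ⟨g, h, hT⟩ ⟨g', h', hT'⟩ =>
    ⟨g * g', by rw [image_act_mul, h, h'], by rw [image_act_mul, hT, hT']⟩

/-- `T`-equivalence as an equivalence relation on the `T`-secondary cones. -/
def tSetoid (T : Submodule ℝ (Matrix (Fin d) (Fin d) ℝ)) : Setoid (tSecondaryCones T) where
  r C C' := TEquivalent T C.1 C'.1
  iseqv := (tEquivalent_equivalence T).comap Subtype.val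

/-- The space of invariant forms of `G`: all symmetric `Q` with `gᵗ Q g = Q` for all `g ∈ G`. -/
def invariantForms (G : Subgroup (GL (Fin d) ℤ)) :
    Submodule ℝ (Matrix (Fin d) (Fin d) ℝ) where
  carrier := {Q | Q.IsSymm ∧ ∀ g ∈ G, act g Q = Q}
  zero_mem' := ⟨Matrix.isSymm_zero, fun g _ => by simp [act]⟩
  add_mem' := fun {P Q} hP hQ => ⟨hP.1.add hQ.1, fun g hg => by
    have h1 := hP.2 g hg
    have h2 := hQ.2 g hg
    simp only [act, Matrix.mul_add, Matrix.add_mul] at *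
    rw [h1, h2]⟩
  smul_mem' := fun a Q hQ => ⟨hQ.1.smul a, fun g hg => by
    have h1 := hQ.2 g hg
    simp only [act, Matrix.mul_smul, Matrix.smul_mul] at *
    rw [h1]⟩

end Voronoi

/-!
Two `T`-secondary cones are `T`-equivalent as soon as some `h ∈ GL_d(ℤ)` normalizes `G` and carries
the Delone subdivision of an invariant form of the first cone to that of an invariant form of
the second. The proof attaches to an invariant form `Q` of the rational closure a label from a
finite set, its `fingerprint`, from which both the subdivision and the group can be recovered up to
such an `h` (`tEquivalent_of_fingerprint_eq`).

Fix a `G`-invariant positive definite form `P`, and let `L` be the lattice of integral zeros of `Q`.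
The argument rests on the set `S` of parity minimal vectors, those `v ∈ ℤ^d` that have minimal
`Q`-length in `v + 2ℤ^d` and minimal `P`-length in `v + 2L` (`parityMinimal`). It is `G`-invariant
and has the following properties.

* `S` contains `d` independent vectors, and `S ∩ L` determines `L`, since every class modulo `2` is
  represented (`exists_det_ne_zero`, `mem_kernel_iff_exists_smul_mem_span`).
* Any `d` vectors of `S` have determinant at most `(d + 1) ^ d` in absolute value (`abs_det_le`).
  Writing `Q(·,·)` for the bilinear form, minimality says `|Q(v, z)| ≤ Q(z, z)` for all `z ∈ ℤ^d`, so
  a lattice point `z = ∑ sᵢ vᵢ` with `∑ |sᵢ| < 1` has `Q(z, z) = 0`; the same argument with `P` on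
  `L` gives `z = 0`. By the pigeonhole principle such a `z ≠ 0` exists if the determinant is large.
* The vertex set of a Delone polyhedron with vertex `0` is the union of the cosets of `L` through
  its members in `S` (`mem_iff_of_mem_nearestSets`).

Hence, in the coordinates given by `d` independent vectors of `S`, the set `S`, the star of `0` in
the Delone subdivision and the action of `G` on these vectors are bounded integral data, once
multiplied by the determinant `k` (`finite_fingerprint`). Two integral matrices with determinant
`k ≠ 0` that agree modulo `k` differ by a left factor in `GL_d(ℤ)` (`exists_mul_eq_of_emod_det`),
and this factor is the required `h`. Positive semidefinite forms need no separate treatment.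
-/

open scoped Matrix MatrixGroups

namespace Voronoi

variable {d : ℕ}

/-! ### Real-valued forms on the integer lattice -/

/-- Bilinear forms `ℤ^d × ℤ^d → ℝ`. -/
abbrev LatticeForm (d : ℕ) : Type := (Fin d → ℤ) →ₗ[ℤ] (Fin d → ℤ) →ₗ[ℤ] ℝ

/-- A symmetric positive semidefinite form on `ℤ^d` whose quadratic form attains its minimum on
every non-empty set of lattice points. The last condition is what rationality of the kernel
provides: it fails for a real semidefinite form with irrational kernel. -/
structure LatticeForm.IsTame (b : LatticeForm d) : Prop where
  symm : ∀ x y, b x y = b y x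
  nonneg : ∀ x, 0 ≤ b x x
  exists_min : ∀ A : Set (Fin d → ℤ), A.Nonempty → ∃ a ∈ A, ∀ x ∈ A, b a a ≤ b x x

theorem LatticeForm.smul_left (b : LatticeForm d) (n : ℤ) (x y : Fin d → ℤ) :
    b (n • x) y = n * b x y := by
  rw [map_smul, LinearMap.smul_apply, zsmul_eq_mul]

theorem LatticeForm.smul_right (b : LatticeForm d) (n : ℤ) (x y : Fin d → ℤ) :
    b x (n • y) = n * b x y := by
  rw [map_smul, zsmul_eq_mul]

/-- Expansion of `b (u - 2x) (u - 2x)`. -/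
theorem LatticeForm.IsTame.apply_le_of_le_sub {b : LatticeForm d} (hb : b.IsTame)
    {u x : Fin d → ℤ} (h : b u u ≤ b (u - (2 : ℤ) • x) (u - (2 : ℤ) • x)) : b u x ≤ b x x := by
  simp only [map_sub, LinearMap.sub_apply, b.smul_left, b.smul_right, hb.symm x u,
    Int.cast_ofNat] at h
  linarith

namespace LatticeForm.IsTame

variable {b p : LatticeForm d}

theorem apply_eq_zero (hb : b.IsTame) {w : Fin d → ℤ} (hw : b w w = 0) (x : Fin d → ℤ) :
    b x w = 0 := by
  by_contra hne
  have key : ∀ n : ℤ, 0 ≤ b x x + 2 * n * b x w := fun n => by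
    have h := hb.nonneg (x + n • w)
    simp only [map_add, LinearMap.add_apply, b.smul_left, b.smul_right, hb.symm w x, hw] at h
    linarith
  obtain ⟨n, hn⟩ := exists_nat_gt (b x x / (2 * |b x w|))
  have hpos : 0 < |b x w| := abs_pos.mpr hne
  rw [div_lt_iff₀ (by positivity)] at hn
  have h1 := key n
  have h2 := key (-n)
  push_cast at h1 h2
  rcases abs_cases (b x w) with ⟨h, _⟩ | ⟨h, _⟩ <;> rw [h] at hn <;> linarith

/-- The lattice points at which a tame form vanishes. -/
def kernel (hb : b.IsTame) : Submodule ℤ (Fin d → ℤ) where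
  carrier := {w | b w w = 0}
  zero_mem' := by simp
  add_mem' := fun {x y} hx hy => by
    have h1 := hb.apply_eq_zero hy x
    have h2 := hb.apply_eq_zero hx y
    simp only [Set.mem_ofPred_eq] at hx hy ⊢
    simp [hx, hy, h1, h2]
  smul_mem' := fun n x hx => by
    simp only [Set.mem_ofPred_eq] at hx ⊢
    rw [b.smul_left, b.smul_right, hx, mul_zero, mul_zero]

theorem mem_kernel (hb : b.IsTame) {w : Fin d → ℤ} : w ∈ hb.kernel ↔ b w w = 0 := Iff.rfl

end LatticeForm.IsTame

/-- The lattice vectors `v` such that `v` is shortest in `v + 2ℤ^d` for `b` and shortest in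
`v + 2L` for `p`, where `L` is the kernel of `b`. Minimality is encoded by the equivalent
inequalities obtained by expanding `b (v - 2w) (v - 2w)` and `p (v - 2w) (v - 2w)`. -/
def parityMinimal (b p : LatticeForm d) : Set (Fin d → ℤ) :=
  {v | (∀ w, b v w ≤ b w w) ∧ ∀ w, b w w = 0 → p v w ≤ p w w}

theorem exists_parityMinimal_sub {b p : LatticeForm d} (hb : b.IsTame) (hp : p.IsTame)
    {v : Fin d → ℤ} (hv : ∀ w, b v w ≤ b w w) :
    ∃ w ∈ hb.kernel, v - (2 : ℤ) • w ∈ parityMinimal b p := by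
  obtain ⟨_, ⟨w, hw, rfl⟩, hmin⟩ := hp.exists_min ((fun w => v - (2 : ℤ) • w) '' hb.kernel)
    ⟨_, 0, hb.kernel.zero_mem, rfl⟩
  refine ⟨w, hw, fun x => ?_, fun x hx => ?_⟩
  · have : b w x = 0 := by rw [hb.symm, hb.apply_eq_zero hw]
    rw [map_sub, LinearMap.sub_apply, b.smul_left, this, mul_zero, sub_zero]
    exact hv x
  · have h := hmin _ ⟨w + x, hb.kernel.add_mem hw hx, rfl⟩
    simp only at h
    have e : v - (2 : ℤ) • (w + x) = (v - (2 : ℤ) • w) - (2 : ℤ) • x := by module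
    rw [e] at h
    exact hp.apply_le_of_le_sub h

theorem exists_parityMinimal_sub_two_smul {b p : LatticeForm d} (hb : b.IsTame) (hp : p.IsTame)
    (v : Fin d → ℤ) : ∃ w, v - (2 : ℤ) • w ∈ parityMinimal b p := by
  obtain ⟨_, ⟨w, rfl⟩, hmin⟩ := hb.exists_min (Set.range fun w => v - (2 : ℤ) • w) ⟨_, 0, rfl⟩
  obtain ⟨w', -, hw'⟩ := exists_parityMinimal_sub hb hp (v := v - (2 : ℤ) • w) fun x => by
    have h := hmin _ ⟨w + x, rfl⟩
    simp only at h
    have e : v - (2 : ℤ) • (w + x) = (v - (2 : ℤ) • w) - (2 : ℤ) • x := by module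
    rw [e] at h
    exact hb.apply_le_of_le_sub h
  exact ⟨w + w', by convert hw' using 1; module⟩

/-- Some `d` vectors of `parityMinimal b p` are linearly independent: choose one in each class
`e_i + 2ℤ^d`; the resulting matrix is the identity modulo `2`, so its determinant is odd. -/
theorem exists_det_ne_zero {b p : LatticeForm d} (hb : b.IsTame) (hp : p.IsTame) :
    ∃ V : Matrix (Fin d) (Fin d) ℤ, V.det ≠ 0 ∧ ∀ j, V.col j ∈ parityMinimal b p := by
  choose w hw using fun j : Fin d =>
    exists_parityMinimal_sub_two_smul hb hp (Pi.single j 1 : Fin d → ℤ)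
  refine ⟨Matrix.of fun i j => (Pi.single j 1 - (2 : ℤ) • w j : Fin d → ℤ) i, fun h0 => ?_,
    fun j => by convert hw j using 1; ext k; simp [Matrix.col_apply]⟩
  have h := congrArg (Int.castRingHom (ZMod 2)) h0
  rw [RingHom.map_det] at h
  have e : (Int.castRingHom (ZMod 2)).mapMatrix
      (Matrix.of fun i j => (Pi.single j 1 - (2 : ℤ) • w j : Fin d → ℤ) i) = 1 := by
    ext i j
    have h2 : (2 : ZMod 2) = 0 := rfl
    simp [Matrix.one_apply, Pi.single_apply, h2]
  rw [e] at h
  simp at h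

/-- The kernel `L` of `b` is the saturation of the lattice spanned by `parityMinimal b p ∩ L`.
That lattice meets every class of `L` modulo `2L`, hence has odd index in `L` by Nakayama. -/
theorem mem_kernel_iff_exists_smul_mem_span {b p : LatticeForm d} (hb : b.IsTame) (hp : p.IsTame)
    (z : Fin d → ℤ) : z ∈ hb.kernel ↔
      ∃ r : ℤ, r ≠ 0 ∧ r • z ∈ Submodule.span ℤ (parityMinimal b p ∩ hb.kernel) := by
  constructor
  · intro hz
    obtain ⟨r, hr, hle⟩ := Submodule.exists_sub_one_mem_and_smul_le_of_fg_of_le_sup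
      (I := Ideal.span {(2 : ℤ)}) (N := Submodule.span ℤ (parityMinimal b p ∩ hb.kernel))
      (N' := hb.kernel) (P := hb.kernel) (IsNoetherian.noetherian _) le_rfl (fun x hx => by
        obtain ⟨w, hw, hv⟩ := exists_parityMinimal_sub hb hp (v := x) fun y => by
          rw [hb.symm, hb.apply_eq_zero hx]; exact hb.nonneg y
        have e : x = (x - (2 : ℤ) • w) + (2 : ℤ) • w := by module
        rw [e]
        refine Submodule.add_mem_sup (Submodule.subset_span
          ⟨hv, hb.kernel.sub_mem hx (hb.kernel.smul_mem _ hw)⟩) ?_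
        exact Submodule.smul_mem_smul (Ideal.mem_span_singleton_self _) hw)
    refine ⟨r, ?_, hle (Submodule.smul_mem_pointwise_smul _ _ _ hz)⟩
    rintro rfl
    rw [Ideal.mem_span_singleton] at hr
    omega
  · rintro ⟨r, hr, h⟩
    have h' : r • z ∈ hb.kernel := Submodule.span_le.mpr Set.inter_subset_right h
    rw [hb.mem_kernel, b.smul_left, b.smul_right] at h'
    simpa [hr, hb.mem_kernel] using h'

/-- If the columns of `V` are in `parityMinimal b p`, then the box `∑ |a i| < |det V|` contains the
coordinate vector of no lattice point but `0`: pairing `det V • z = ∑ a i • v i` with `z` gives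
`b z z = 0`, and then also `p z z = 0`. -/
theorem eq_zero_of_sum_abs_cramer_lt {b p : LatticeForm d} (hb : b.IsTame) (hp : p.IsTame)
    (hpos : ∀ z, p z z = 0 → z = 0) {V : Matrix (Fin d) (Fin d) ℤ}
    (hV : ∀ j, V.col j ∈ parityMinimal b p) {z : Fin d → ℤ}
    (hz : ∑ i, |V.cramer z i| < |V.det|) : z = 0 := by
  have hsum : V.det • z = ∑ i, V.cramer z i • V.col i := by
    rw [← Matrix.mulVec_cramer, Matrix.mulVec_eq_sum]
    simp [Matrix.col_def]
  have hlt : ∑ i, |(V.cramer z i : ℝ)| < |(V.det : ℝ)| := by exact_mod_cast hz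
  have key : ∀ q : LatticeForm d, 0 ≤ q z z → (∀ i, |q (V.col i) z| ≤ q z z) → q z z = 0 := by
    intro q h0 hq
    have e : (V.det : ℝ) * q z z = ∑ i, (V.cramer z i : ℝ) * q (V.col i) z := by
      have := congrArg (fun y => q y z) hsum
      simpa only [map_sum, LinearMap.sum_apply, q.smul_left] using this
    have h1 : |(V.det : ℝ)| * q z z ≤ (∑ i, |(V.cramer z i : ℝ)|) * q z z := by
      rw [← abs_of_nonneg h0, ← abs_mul, abs_of_nonneg h0, e, Finset.sum_mul]
      refine (Finset.abs_sum_le_sum_abs _ _).trans (Finset.sum_le_sum fun i _ => ?_)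
      rw [abs_mul]
      exact mul_le_mul_of_nonneg_left (hq i) (abs_nonneg _)
    by_contra hne
    exact absurd (le_of_mul_le_mul_right h1 (lt_of_le_of_ne h0 (Ne.symm hne))) (not_le.mpr hlt)
  have hbz : b z z = 0 := key b (hb.nonneg z) fun i => by
    have h1 := (hV i).1 z
    have h2 := (hV i).1 (-z)
    simp only [map_neg, LinearMap.neg_apply, neg_neg] at h2
    exact abs_le.mpr ⟨by linarith, h1⟩
  refine hpos z (key p (hp.nonneg z) fun i => ?_)
  have h1 := (hV i).2 z hbz
  have h2 := (hV i).2 (-z) (by simpa using hbz)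
  simp only [map_neg, LinearMap.neg_apply, neg_neg] at h2
  exact abs_le.mpr ⟨by linarith, h1⟩

/-! ### A bound for determinants -/

theorem natCard_quotient_range_mulVecLin {V : Matrix (Fin d) (Fin d) ℤ} (hV : V.det ≠ 0) :
    Nat.card ((Fin d → ℤ) ⧸ LinearMap.range V.mulVecLin) = V.det.natAbs := by
  have hinj : Function.Injective V.mulVecLin := (injective_iff_map_eq_zero _).mpr fun x hx =>
    Matrix.eq_zero_of_mulVec_eq_zero hV hx
  have h := Submodule.natAbs_det_equiv (LinearMap.range V.mulVecLin)
    (LinearEquiv.ofInjective V.mulVecLin hinj)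
  rw [← h]
  congr 1
  have hdet : LinearMap.det V.mulVecLin = V.det := LinearMap.det_toLin' V
  rw [← hdet]
  rfl

/-- By the pigeonhole principle, if `|det V| > (d + 1) ^ d` then the Cramer coordinates of some
non-zero lattice point have sum of absolute values less than `|det V|`. -/
theorem exists_ne_zero_sum_abs_cramer_lt {V : Matrix (Fin d) (Fin d) ℤ}
    (hN : (d + 1) ^ d < V.det.natAbs) :
    ∃ z : Fin d → ℤ, z ≠ 0 ∧ ∑ i, |V.cramer z i| < |V.det| := by
  have hV : V.det ≠ 0 := by rintro h; simp [h] at hN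
  have hkpos : 0 < |V.det| := abs_pos.mpr hV
  have hcard := natCard_quotient_range_mulVecLin hV
  -- the bucket of a lattice point, from the residues of its Cramer coordinates modulo `det V`
  let g : (Fin d → ℤ) → Fin d → ℤ := fun x i => (d + 1) * (V.cramer x i % V.det) / |V.det|
  have hg : ∀ x i, g x i ∈ Finset.Ico (0 : ℤ) (d + 1) := fun x i => by
    have h1 := Int.emod_nonneg (V.cramer x i) hV
    have h2 := Int.emod_lt_abs (V.cramer x i) hV
    exact Finset.mem_Ico.mpr ⟨Int.ediv_nonneg (by positivity) hkpos.le,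
      Int.ediv_lt_of_lt_mul hkpos (mul_lt_mul_of_pos_left h2 (by positivity))⟩
  let f : ((Fin d → ℤ) ⧸ LinearMap.range V.mulVecLin) → Fin d → Finset.Ico (0 : ℤ) (d + 1) :=
    fun x i => ⟨g x.out i, hg _ _⟩
  have hf : ¬ Function.Injective f := fun hinj => by
    have h := Nat.card_le_card_of_injective f hinj
    rw [hcard] at h
    simp only [Nat.card_eq_fintype_card, Fintype.card_pi, Fintype.card_coe, Int.card_Ico,
      Finset.prod_const, Finset.card_univ, Fintype.card_fin] at h
    have : ((d : ℤ) + 1 - 0).toNat = d + 1 := by omega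
    rw [this] at h
    omega
  simp only [Function.Injective, not_forall] at hf
  obtain ⟨x, y, hxy, hne⟩ := hf
  have hgxy : ∀ i, g x.out i = g y.out i := fun i => congrArg Subtype.val (congrFun hxy i)
  let m : Fin d → ℤ := fun i => V.cramer x.out i / V.det - V.cramer y.out i / V.det
  refine ⟨x.out - y.out - V *ᵥ m, fun h0 => hne ?_, ?_⟩
  · have hmem : x.out - y.out ∈ LinearMap.range V.mulVecLin :=
      ⟨m, (sub_eq_zero.mp h0).symm⟩
    rw [← Submodule.Quotient.eq] at hmem
    simpa using hmem
  · have hcoord : ∀ i, V.cramer (x.out - y.out - V *ᵥ m) i =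
        V.cramer x.out i % V.det - V.cramer y.out i % V.det := fun i => by
      have e : V.cramer (V *ᵥ m) = V.det • m := by
        rw [Matrix.cramer_eq_adjugate_mulVec, Matrix.mulVec_mulVec, Matrix.adjugate_mul,
          Matrix.smul_mulVec, Matrix.one_mulVec]
      rw [map_sub, map_sub, e]
      simp only [Pi.sub_apply, Pi.smul_apply, smul_eq_mul, m]
      rw [Int.emod_def, Int.emod_def]
      ring
    -- points in the same bucket have residues differing by less than `|det V| / (d + 1)`
    have hlt : ∀ i, (d + 1) * |V.cramer (x.out - y.out - V *ᵥ m) i| ≤ |V.det| := fun i => by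
      rw [hcoord]
      have h := hgxy i
      simp only [g] at h
      generalize V.cramer x.out i % V.det = r at h ⊢
      generalize V.cramer y.out i % V.det = s at h ⊢
      have h1 := Int.mul_ediv_add_emod ((d + 1) * r) |V.det|
      have h2 := Int.mul_ediv_add_emod ((d + 1) * s) |V.det|
      have h3 := Int.emod_nonneg ((d + 1) * r) hkpos.ne'
      have h4 := Int.emod_nonneg ((d + 1) * s) hkpos.ne'
      have h5 := Int.emod_lt_of_pos ((d + 1) * r) hkpos
      have h6 := Int.emod_lt_of_pos ((d + 1) * s) hkpos
      rw [h] at h1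
      have hd : (0 : ℤ) ≤ d + 1 := by positivity
      rw [← abs_of_nonneg hd, ← abs_mul, abs_le]
      constructor <;> linarith
    have hsum := Finset.sum_le_sum fun i (_ : i ∈ Finset.univ) => hlt i
    rw [← Finset.mul_sum, Finset.sum_const, Finset.card_univ, Fintype.card_fin, nsmul_eq_mul]
      at hsum
    have hd : (0 : ℤ) < d + 1 := by positivity
    refine lt_of_mul_lt_mul_left (a := (d + 1 : ℤ)) (hsum.trans_lt ?_) hd.le
    exact mul_lt_mul_of_pos_right (by omega) hkpos

/-- Determinants of `d` vectors of `parityMinimal b p` are bounded in terms of `d` only. -/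
theorem abs_det_le {b p : LatticeForm d} (hb : b.IsTame) (hp : p.IsTame)
    (hpos : ∀ z, p z z = 0 → z = 0) {V : Matrix (Fin d) (Fin d) ℤ}
    (hV : ∀ j, V.col j ∈ parityMinimal b p) : |V.det| ≤ (d + 1) ^ d := by
  by_contra h
  obtain ⟨z, hz, hlt⟩ := exists_ne_zero_sum_abs_cramer_lt (V := V) (by
    zify; exact not_le.mp h)
  exact hz (eq_zero_of_sum_abs_cramer_lt hb hp hpos hV hlt)

/-- By Cramer's rule the coordinates of `parityMinimal b p` in terms of `d` of its members are
determinants of such vectors as well. -/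
theorem abs_cramer_le {b p : LatticeForm d} (hb : b.IsTame) (hp : p.IsTame)
    (hpos : ∀ z, p z z = 0 → z = 0) {V : Matrix (Fin d) (Fin d) ℤ}
    (hV : ∀ j, V.col j ∈ parityMinimal b p) {x : Fin d → ℤ} (hx : x ∈ parityMinimal b p)
    (i : Fin d) : |V.cramer x i| ≤ (d + 1) ^ d := by
  rw [Matrix.cramer_apply]
  refine abs_det_le hb hp hpos fun j => ?_
  by_cases h : j = i
  · subst h
    convert hx
    ext k
    simp [Matrix.col_apply]
  · convert hV j using 1
    ext k
    simp [Matrix.col_apply, Matrix.updateCol_ne h]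

/-- Integral matrices of the same non-zero determinant that agree modulo this determinant
differ by a unimodular left factor. -/
theorem exists_mul_eq_of_emod_det {V W : Matrix (Fin d) (Fin d) ℤ} (hdet : V.det = W.det)
    (hV : V.det ≠ 0) (hmod : ∀ i j, V i j % V.det = W i j % V.det) :
    ∃ h : GL (Fin d) ℤ, (h : Matrix (Fin d) (Fin d) ℤ) * V = W := by
  have hdvd : ∀ i j, V.det ∣ W i j - V i j := fun i j =>
    Int.ModEq.dvd (hmod i j)
  choose E hE using hdvd
  have hW : W = V + V.det • Matrix.of E := by
    ext i j
    have := hE i j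
    simp only [Matrix.add_apply, Matrix.smul_apply, Matrix.of_apply, smul_eq_mul]
    linarith
  set H : Matrix (Fin d) (Fin d) ℤ := 1 + Matrix.of E * V.adjugate with hH
  have hHV : H * V = W := by
    rw [hH, Matrix.add_mul, Matrix.one_mul, Matrix.mul_assoc, Matrix.adjugate_mul,
      Matrix.mul_smul, Matrix.mul_one, ← hW]
  have hHdet : H.det = 1 := by
    have h := congrArg Matrix.det hHV
    rw [Matrix.det_mul, ← hdet] at h
    exact mul_right_cancel₀ hV (by rw [h, one_mul])
  exact ⟨Matrix.GeneralLinearGroup.mk'' H (by rw [hHdet]; exact isUnit_one), hHV⟩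

/-! ### Forms in the rational closure on the integer lattice -/

/-- An integral vector as a real vector. -/
def intVec (z : Fin d → ℤ) : Fin d → ℝ := fun i => z i

theorem intVec_add (x y : Fin d → ℤ) : intVec (x + y) = intVec x + intVec y := by
  ext i; simp [intVec]

theorem intVec_smul (n : ℤ) (x : Fin d → ℤ) : intVec (n • x) = (n : ℝ) • intVec x := by
  ext i; simp [intVec]

theorem intVec_mulVec {n : ℕ} (A : Matrix (Fin n) (Fin d) ℤ) (z : Fin d → ℤ) :
    intVec (A *ᵥ z) = A.map (Int.cast : ℤ → ℝ) *ᵥ intVec z := by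
  ext i; simp [intVec, Matrix.mulVec, dotProduct]

theorem toReal_mulVec_intVec (g : GL (Fin d) ℤ) (z : Fin d → ℤ) :
    toReal g *ᵥ intVec z = intVec (g.1 *ᵥ z) :=
  (intVec_mulVec g.1 z).symm

theorem toReal_inv_mul (g : GL (Fin d) ℤ) : toReal g⁻¹ * toReal g = 1 := by
  rw [← toReal_mul, inv_mul_cancel, toReal_one]

theorem toReal_mul_inv (g : GL (Fin d) ℤ) : toReal g * toReal g⁻¹ = 1 := by
  rw [← toReal_mul, mul_inv_cancel, toReal_one]

theorem act_inv_act (g : GL (Fin d) ℤ) (Q : Matrix (Fin d) (Fin d) ℝ) :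
    act g⁻¹ (act g Q) = Q := by
  rw [← act_mul, mul_inv_cancel, act_one]

theorem act_act_inv (g : GL (Fin d) ℤ) (Q : Matrix (Fin d) (Fin d) ℝ) :
    act g (act g⁻¹ Q) = Q := by
  rw [← act_mul, inv_mul_cancel, act_one]

theorem dotProduct_act_mulVec (g : GL (Fin d) ℤ) (Q : Matrix (Fin d) (Fin d) ℝ)
    (x y : Fin d → ℝ) :
    x ⬝ᵥ (act g Q *ᵥ y) = (toReal g *ᵥ x) ⬝ᵥ (Q *ᵥ (toReal g *ᵥ y)) := by
  rw [act, ← Matrix.mulVec_mulVec, ← Matrix.mulVec_mulVec, Matrix.dotProduct_mulVec,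
    Matrix.vecMul_transpose]

theorem qval_act (g : GL (Fin d) ℤ) (Q : Matrix (Fin d) (Fin d) ℝ) (x : Fin d → ℝ) :
    qval (act g Q) x = qval Q (toReal g *ᵥ x) :=
  dotProduct_act_mulVec g Q x x

theorem isSymm_act {Q : Matrix (Fin d) (Fin d) ℝ} (hQ : Q.IsSymm) (g : GL (Fin d) ℤ) :
    (act g Q).IsSymm := by
  rw [Matrix.IsSymm, act, Matrix.transpose_mul, Matrix.transpose_mul, Matrix.transpose_transpose,
    hQ.eq, Matrix.mul_assoc]

/-- The restriction to `ℤ^d` of the bilinear form of a real matrix. -/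
def latticeForm (Q : Matrix (Fin d) (Fin d) ℝ) : LatticeForm d :=
  LinearMap.mk₂ ℤ (fun x y => intVec x ⬝ᵥ (Q *ᵥ intVec y))
    (fun x y z => by rw [intVec_add, add_dotProduct])
    (fun n x y => by rw [intVec_smul, smul_dotProduct, zsmul_eq_mul, smul_eq_mul])
    (fun x y z => by rw [intVec_add, Matrix.mulVec_add, dotProduct_add])
    (fun n x y => by
      rw [intVec_smul, Matrix.mulVec_smul, dotProduct_smul, zsmul_eq_mul, smul_eq_mul])

theorem latticeForm_apply (Q : Matrix (Fin d) (Fin d) ℝ) (x y : Fin d → ℤ) :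
    latticeForm Q x y = intVec x ⬝ᵥ (Q *ᵥ intVec y) := rfl

theorem latticeForm_self (Q : Matrix (Fin d) (Fin d) ℝ) (x : Fin d → ℤ) :
    latticeForm Q x x = qval Q (intVec x) := rfl

theorem latticeForm_act (g : GL (Fin d) ℤ) (Q : Matrix (Fin d) (Fin d) ℝ) (x y : Fin d → ℤ) :
    latticeForm (act g Q) x y = latticeForm Q (g.1 *ᵥ x) (g.1 *ᵥ y) := by
  rw [latticeForm_apply, latticeForm_apply, dotProduct_act_mulVec, toReal_mulVec_intVec,
    toReal_mulVec_intVec]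

/-- A positive definite form takes values below a given bound at finitely many lattice points. -/
theorem finite_qval_intVec_le {Q : Matrix (Fin d) (Fin d) ℝ} (hQ : Q.PosDef) (C : ℝ) :
    {z : Fin d → ℤ | qval Q (intVec z) ≤ C}.Finite := by
  rcases Nat.eq_zero_or_pos d with rfl | hd
  · exact Set.toFinite _
  have : Nonempty (Fin d) := ⟨⟨0, hd⟩⟩
  have hcont : Continuous (qval Q) := by unfold qval; fun_prop
  obtain ⟨x₀, hx₀, hmin⟩ := (isCompact_sphere (0 : Fin d → ℝ) 1).exists_isMinOn
    (NormedSpace.sphere_nonempty.mpr zero_le_one) hcont.continuousOn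
  have hm : 0 < qval Q x₀ := by
    refine hQ.dotProduct_mulVec_pos (x := x₀) ?_
    rintro rfl
    simp at hx₀
  have hbound : ∀ x, qval Q x₀ * ‖x‖ ^ 2 ≤ qval Q x := fun x => by
    rcases eq_or_ne x 0 with rfl | hx
    · simp [qval]
    have hx' : ‖x‖ ≠ 0 := norm_ne_zero_iff.mpr hx
    have h := hmin (show ‖x‖⁻¹ • x ∈ Metric.sphere 0 1 by simp [norm_smul, hx'])
    have e : qval Q (‖x‖⁻¹ • x) = (‖x‖ ^ 2)⁻¹ * qval Q x := by
      simp only [qval, Matrix.mulVec_smul, smul_dotProduct, dotProduct_smul, smul_eq_mul]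
      field_simp
    simp only [Set.mem_ofPred_eq, e] at h
    rwa [inv_mul_eq_div, le_div_iff₀ (by positivity)] at h
  obtain ⟨N, hN⟩ := exists_nat_gt (C / qval Q x₀)
  refine (Set.finite_Icc (fun _ => -(N : ℤ)) (fun _ => (N : ℤ))).subset fun z hz => ?_
  have hz1 : ∀ i, |z i| ≤ (N : ℤ) := fun i => by
    have h1 : |(z i : ℝ)| ≤ ‖intVec z‖ := norm_le_pi_norm (intVec z) i
    have h2 : qval Q x₀ * ‖intVec z‖ ^ 2 ≤ C := (hbound _).trans hz
    rw [div_lt_iff₀ hm] at hN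
    have h3 : ‖intVec z‖ ^ 2 < N := by
      by_contra hcon
      nlinarith
    have h4 : |z i| ^ 2 ≤ (N : ℤ) := by
      have : |(z i : ℝ)| ^ 2 ≤ N := (pow_le_pow_left₀ (abs_nonneg _) h1 2).trans h3.le
      exact_mod_cast this
    have h5 : |z i| ≤ |z i| ^ 2 := Int.le_self_sq _
    omega
  exact ⟨fun i => (abs_le.mp (hz1 i)).1, fun i => (abs_le.mp (hz1 i)).2⟩

/-- Real forms that are pulled back from a positive definite form by an integral matrix. Forms in
the rational closure are of this kind. -/
def IsIntegralPullback (Q : Matrix (Fin d) (Fin d) ℝ) : Prop :=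
  Q.IsSymm ∧ ∃ (n : ℕ) (Q' : Matrix (Fin n) (Fin n) ℝ) (A : Matrix (Fin n) (Fin d) ℤ),
    Q'.PosDef ∧ ∀ x, qval Q x = qval Q' (A.map (Int.cast : ℤ → ℝ) *ᵥ x)

theorem qval_nonneg_of_posDef {Q : Matrix (Fin d) (Fin d) ℝ} (hQ : Q.PosDef) (x : Fin d → ℝ) :
    0 ≤ qval Q x :=
  hQ.posSemidef.dotProduct_mulVec_nonneg x

theorem IsIntegralPullback.qval_nonneg {Q : Matrix (Fin d) (Fin d) ℝ}
    (hQ : IsIntegralPullback Q) (x : Fin d → ℝ) : 0 ≤ qval Q x := by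
  obtain ⟨-, n, Q', A, hQ', h⟩ := hQ
  rw [h]
  exact qval_nonneg_of_posDef hQ' _

theorem IsIntegralPullback.isTame {Q : Matrix (Fin d) (Fin d) ℝ}
    (hQ : IsIntegralPullback Q) : (latticeForm Q).IsTame where
  symm x y := by
    rw [latticeForm_apply, latticeForm_apply, Matrix.dotProduct_mulVec, dotProduct_comm,
      ← Matrix.mulVec_transpose, hQ.1.eq]
  nonneg x := hQ.qval_nonneg _
  exists_min S hS := by
    obtain ⟨-, n, Q', A, hQ', h⟩ := hQ
    obtain ⟨s, hs⟩ := hS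
    have e : ∀ z, latticeForm Q z z = qval Q' (intVec (A *ᵥ z)) := fun z => by
      rw [latticeForm_self, h, intVec_mulVec]
    -- only finitely many points of `A *ᵥ S` compete with the image of `s`
    obtain ⟨_, ⟨⟨a, ha, rfl⟩, ha'⟩, hmin⟩ := Set.exists_min_image
      ((A *ᵥ ·) '' S ∩ {y | qval Q' (intVec y) ≤ qval Q' (intVec (A *ᵥ s))})
      (fun y => qval Q' (intVec y)) ((finite_qval_intVec_le hQ' _).inter_of_right _)
      ⟨_, ⟨s, hs, rfl⟩, le_refl (qval Q' (intVec (A *ᵥ s)))⟩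
    refine ⟨a, ha, fun x hx => ?_⟩
    rw [e, e]
    rcases le_total (qval Q' (intVec (A *ᵥ x))) (qval Q' (intVec (A *ᵥ s))) with hle | hle
    · exact hmin _ ⟨⟨x, hx, rfl⟩, hle⟩
    · exact le_trans ha' hle

theorem isIntegralPullback_of_posDef {Q : Matrix (Fin d) (Fin d) ℝ} (hQ : Q.PosDef) :
    IsIntegralPullback Q :=
  ⟨Matrix.isHermitian_iff_isSymm.mp hQ.isHermitian, d, Q, 1, hQ, fun x => by simp⟩

theorem isIntegralPullback_of_mem_rationalClosure {Q : Matrix (Fin d) (Fin d) ℝ}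
    (hQ : Q ∈ rationalClosure d) : IsIntegralPullback Q := by
  obtain ⟨U, m, n, rfl, Q', hQ', hU⟩ := hQ
  have hsymm : Q'.IsSymm := Matrix.isHermitian_iff_isSymm.mp hQ'.isHermitian
  refine ⟨?_, n, Q', (U⁻¹).1.submatrix (Fin.natAdd m) id, hQ', fun x => ?_⟩
  · rw [← act_inv_act U Q, hU]
    refine isSymm_act ?_ _
    rw [Matrix.IsSymm, Matrix.transpose_reindex, Matrix.fromBlocks_transpose, hsymm.eq]
    simp
  · have e : (Matrix.map ((U⁻¹).1.submatrix (Fin.natAdd m) id) (Int.cast : ℤ → ℝ)) *ᵥ x =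
        fun i => (toReal U⁻¹ *ᵥ x) (Fin.natAdd m i) := rfl
    rw [e]
    conv_lhs => rw [← act_inv_act U Q, qval_act, hU]
    generalize toReal U⁻¹ *ᵥ x = y
    simp only [qval, dotProduct, Matrix.mulVec, Fin.sum_univ_add]
    simp

/-- A finite group of integral matrices fixes a positive definite form. -/
theorem exists_posDef_invariant (G : Subgroup (GL (Fin d) ℤ)) [Finite G] :
    ∃ P : Matrix (Fin d) (Fin d) ℝ, P.PosDef ∧ ∀ g ∈ G, act g P = P := by
  have := Fintype.ofFinite G
  refine ⟨∑ g : G, act g.1 1, ?_, fun h hh => ?_⟩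
  · refine Finset.sum_induction_nonempty _ Matrix.PosDef (fun _ _ => Matrix.PosDef.add)
      Finset.univ_nonempty fun g _ => ?_
    refine Matrix.PosDef.of_dotProduct_mulVec_pos
      (Matrix.isHermitian_iff_isSymm.mpr (isSymm_act Matrix.isSymm_one _)) fun x hx => ?_
    rw [star_trivial, dotProduct_act_mulVec, Matrix.one_mulVec]
    refine (Finset.sum_nonneg fun i _ => mul_self_nonneg _).lt_of_ne' fun h0 => hx ?_
    replace h0 := dotProduct_self_eq_zero.mp h0
    rw [← Matrix.one_mulVec x, ← toReal_inv_mul g.1, ← Matrix.mulVec_mulVec, h0,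
      Matrix.mulVec_zero]
  · have hsum : act h (∑ g : G, act g 1) = ∑ g : G, act (g * ⟨h, hh⟩ : G) 1 := by
      simp only [Subgroup.coe_mul, act_mul]
      simp only [act, Matrix.mul_sum, Matrix.sum_mul]
    rw [hsum]
    exact Fintype.sum_equiv (Equiv.mulRight (⟨h, hh⟩ : G)) _ _ fun _ => rfl

theorem mulVec_mem_parityMinimal {Q P : Matrix (Fin d) (Fin d) ℝ} {g : GL (Fin d) ℤ}
    (hQ : act g Q = Q) (hP : act g P = P) {v : Fin d → ℤ}
    (hv : v ∈ parityMinimal (latticeForm Q) (latticeForm P)) :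
    g.1 *ᵥ v ∈ parityMinimal (latticeForm Q) (latticeForm P) := by
  have key : ∀ w, ∃ w', w = g.1 *ᵥ w' := fun w => ⟨(g⁻¹).1 *ᵥ w, by
    rw [Matrix.mulVec_mulVec, ← Units.val_mul, mul_inv_cancel, Units.val_one, Matrix.one_mulVec]⟩
  refine ⟨fun w => ?_, fun w hw => ?_⟩
  · obtain ⟨w, rfl⟩ := key w
    rw [← latticeForm_act, ← latticeForm_act, hQ]
    exact hv.1 w
  · obtain ⟨w, rfl⟩ := key w
    rw [← latticeForm_act, hQ] at hw
    rw [← latticeForm_act, ← latticeForm_act, hP]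
    exact hv.2 w hw

theorem act_mem_rationalClosure {Q : Matrix (Fin d) (Fin d) ℝ} (hQ : Q ∈ rationalClosure d)
    (g : GL (Fin d) ℤ) : act g Q ∈ rationalClosure d := by
  obtain ⟨U, m, n, h, Q', hQ', hU⟩ := hQ
  exact ⟨g⁻¹ * U, m, n, h, Q', hQ', by rw [act_mul, act_inv_act, hU]⟩

/-! ### Delone polyhedra -/

/-- The vertex sets of the Delone polyhedra of `Q` that have `0` as a vertex, in integral
coordinates: the lattice points nearest to some `c`, provided that `0` is one of them. -/
def nearestSets (Q : Matrix (Fin d) (Fin d) ℝ) : Set (Set (Fin d → ℤ)) :=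
  {W | ∃ c : Fin d → ℝ, W = {z | qval Q (c - intVec z) = qval Q c} ∧
    ∀ z, qval Q c ≤ qval Q (c - intVec z)}

/-- Delone polyhedra are the convex hulls of the lattice translates of `nearestSets Q`. -/
theorem isDelonePolyhedron_iff {Q : Matrix (Fin d) (Fin d) ℝ} (hQ : ∀ x, 0 ≤ qval Q x)
    (P : Set (Fin d → ℝ)) : IsDelonePolyhedron Q P ↔
      ∃ W ∈ nearestSets Q, ∃ z₀ : Fin d → ℤ,
        P = convexHull ℝ ((fun z => intVec (z₀ + z)) '' W) := by
  have hmem : ∀ (z : Fin d → ℤ), intVec z ∈ latticePoints d := fun z => ⟨z, fun _ => rfl⟩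
  have hsub : ∀ (c : Fin d → ℝ) (z₀ z : Fin d → ℤ),
      c - intVec z₀ - intVec z = c - intVec (z₀ + z) := fun c z₀ z => by
    rw [intVec_add, sub_sub]
  have hsphere : ∀ (c : Fin d → ℝ) (r : ℝ) (z₀ : Fin d → ℤ), qval Q (c - intVec z₀) = r ^ 2 →
      spherePoints Q c r = (fun z => intVec (z₀ + z)) ''
        {z | qval Q (c - intVec z₀ - intVec z) = qval Q (c - intVec z₀)} := by
    intro c r z₀ h0
    ext v
    constructor
    · rintro ⟨⟨y, hy⟩, hv⟩
      obtain rfl : v = intVec y := funext hy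
      refine ⟨y - z₀, ?_, by simp⟩
      rw [Set.mem_ofPred_eq, hsub, h0, add_sub_cancel, hv]
    · rintro ⟨z, hz, rfl⟩
      rw [Set.mem_ofPred_eq, hsub, h0] at hz
      exact ⟨hmem _, hz⟩
  constructor
  · rintro ⟨c, r, ⟨v₀, hv₀⟩, hfar, rfl⟩
    obtain ⟨z₀, hz₀⟩ := hv₀.1
    obtain rfl : v₀ = intVec z₀ := funext hz₀
    refine ⟨_, ⟨c - intVec z₀, rfl, fun z => ?_⟩, z₀, by rw [hsphere c r z₀ hv₀.2]⟩
    rw [hsub, hv₀.2]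
    by_cases h : intVec (z₀ + z) ∈ spherePoints Q c r
    · exact h.2.ge
    · exact (hfar _ (hmem _) h).le
  · rintro ⟨_, ⟨c, rfl, hc⟩, z₀, rfl⟩
    have hr : qval Q (c + intVec z₀ - intVec z₀) = Real.sqrt (qval Q c) ^ 2 := by
      rw [add_sub_cancel_right, Real.sq_sqrt (hQ c)]
    refine ⟨c + intVec z₀, Real.sqrt (qval Q c), ⟨intVec z₀, hmem _, hr⟩, ?_, ?_⟩
    · rintro v ⟨y, hy⟩ hv
      obtain rfl : v = intVec y := funext hy
      have e : c + intVec z₀ - intVec y = c - intVec (y - z₀) := by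
        ext i; simp [intVec]; ring
      refine lt_of_le_of_ne ?_ fun h => hv ⟨hmem _, h.symm⟩
      rw [Real.sq_sqrt (hQ c), e]
      exact hc _
    · rw [hsphere _ _ z₀ hr, add_sub_cancel_right]

theorem Del_eq_of_nearestSets_eq {Q Q' : Matrix (Fin d) (Fin d) ℝ} (hQ : ∀ x, 0 ≤ qval Q x)
    (hQ' : ∀ x, 0 ≤ qval Q' x) (h : nearestSets Q = nearestSets Q') : Del Q = Del Q' := by
  ext P
  simp only [Del, Set.mem_ofPred_eq]
  rw [isDelonePolyhedron_iff hQ, isDelonePolyhedron_iff hQ', h]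

theorem preimage_mem_nearestSets_act {Q : Matrix (Fin d) (Fin d) ℝ} (g : GL (Fin d) ℤ)
    {W : Set (Fin d → ℤ)} (hW : W ∈ nearestSets Q) :
    (g.1 *ᵥ ·) ⁻¹' W ∈ nearestSets (act g Q) := by
  obtain ⟨c, rfl, hc⟩ := hW
  have e : toReal g *ᵥ (toReal g⁻¹ *ᵥ c) = c := by
    rw [Matrix.mulVec_mulVec, toReal_mul_inv, Matrix.one_mulVec]
  refine ⟨toReal g⁻¹ *ᵥ c, ?_, fun z => ?_⟩
  · ext z
    simp only [Set.mem_preimage, Set.mem_ofPred_eq, qval_act, Matrix.mulVec_sub, e,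
      toReal_mulVec_intVec]
  · rw [qval_act, qval_act, Matrix.mulVec_sub, e, toReal_mulVec_intVec]
    exact hc _

theorem image_mem_Del {Q : Matrix (Fin d) (Fin d) ℝ} (g : GL (Fin d) ℤ)
    {P : Set (Fin d → ℝ)} (hP : P ∈ Del (act g Q)) : (toReal g).mulVecLin '' P ∈ Del Q := by
  obtain ⟨c, r, hne, hfar, rfl⟩ := hP
  have hmem : ∀ (g : GL (Fin d) ℤ) {v}, v ∈ latticePoints d → toReal g *ᵥ v ∈ latticePoints d := by
    rintro g v ⟨z, hz⟩
    obtain rfl : v = intVec z := funext hz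
    exact ⟨g.1 *ᵥ z, fun i => by rw [toReal_mulVec_intVec]; rfl⟩
  have hval : ∀ v, qval Q (toReal g *ᵥ c - v) = qval (act g Q) (c - toReal g⁻¹ *ᵥ v) := fun v => by
    rw [qval_act, Matrix.mulVec_sub, Matrix.mulVec_mulVec, toReal_mul_inv, Matrix.one_mulVec]
  have himage : (toReal g).mulVecLin '' spherePoints (act g Q) c r =
      spherePoints Q (toReal g *ᵥ c) r := by
    ext v
    constructor
    · rintro ⟨u, hu, rfl⟩
      refine ⟨hmem g hu.1, ?_⟩
      rw [Matrix.mulVecLin_apply, ← Matrix.mulVec_sub, ← qval_act, hu.2]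
    · intro hv
      refine ⟨toReal g⁻¹ *ᵥ v, ⟨hmem _ hv.1, by rw [← hval, hv.2]⟩, ?_⟩
      rw [Matrix.mulVecLin_apply, Matrix.mulVec_mulVec, toReal_mul_inv, Matrix.one_mulVec]
  refine ⟨toReal g *ᵥ c, r, himage ▸ hne.image _, fun v hv hv' => ?_, ?_⟩
  · rw [hval]
    exact hfar _ (hmem _ hv) fun h => hv' ⟨hv, by rw [hval, h.2]⟩
  · rw [LinearMap.image_convexHull, himage]

/-- The Delone subdivision of `act g Q` is determined by that of `Q`. -/
theorem Del_act_eq {Q Q' : Matrix (Fin d) (Fin d) ℝ} (h : Del Q = Del Q') (g : GL (Fin d) ℤ) :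
    Del (act g Q) = Del (act g Q') := by
  have key : ∀ {X Y : Matrix (Fin d) (Fin d) ℝ}, Del X = Del Y →
      Del (act g X) ⊆ Del (act g Y) := fun {X Y} hXY P hP => by
    have h1 := image_mem_Del g hP
    rw [hXY, ← act_inv_act g Y] at h1
    have h2 := image_mem_Del g⁻¹ h1
    rw [← Set.image_comp, ← LinearMap.coe_comp, ← Matrix.mulVecLin_mul, toReal_inv_mul,
      Matrix.mulVecLin_one] at h2
    simpa using h2
  exact (key h).antisymm (key h.symm)

/-- A set in `nearestSets Q` is a union of cosets of the kernel of `Q`, each of which contains a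
parity minimal vector. -/
theorem mem_iff_of_mem_nearestSets {Q : Matrix (Fin d) (Fin d) ℝ} {p : LatticeForm d}
    (hQ : IsIntegralPullback Q) (hp : p.IsTame)
    {W : Set (Fin d → ℤ)} (hW : W ∈ nearestSets Q) (z : Fin d → ℤ) :
    z ∈ W ↔ ∃ u ∈ W ∩ parityMinimal (latticeForm Q) p, latticeForm Q (z - u) (z - u) = 0 := by
  obtain ⟨c, rfl, hc⟩ := hW
  have hb := hQ.isTame
  set b := latticeForm Q with hbdef
  -- the linear functional pairing a lattice point with the centre
  let l : (Fin d → ℤ) → ℝ := fun z => c ⬝ᵥ (Q *ᵥ intVec z)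
  have hladd : ∀ x y, l (x + y) = l x + l y := fun x y => by
    simp only [l, intVec_add, Matrix.mulVec_add, dotProduct_add]
  have hlneg : ∀ x, l (-x) = -l x := fun x => by
    have := hladd x (-x)
    have h0 : l 0 = 0 := by simpa using hladd 0 0
    rw [add_neg_cancel, h0] at this
    linarith
  have hexp : ∀ x, qval Q (c - intVec x) = qval Q c - 2 * l x + b x x := fun x => by
    have hs : intVec x ⬝ᵥ (Q *ᵥ c) = l x := by
      rw [Matrix.dotProduct_mulVec, dotProduct_comm, ← Matrix.mulVec_transpose, hQ.1.eq]
    rw [hbdef, latticeForm_self]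
    simp only [qval, Matrix.mulVec_sub, dotProduct_sub, sub_dotProduct, hs, l]
    ring
  have hle : ∀ x, 2 * l x ≤ b x x := fun x => by
    have := hc x
    rw [hexp] at this
    linarith
  have hmem : ∀ x, x ∈ {z | qval Q (c - intVec z) = qval Q c} ↔ b x x = 2 * l x := fun x => by
    rw [Set.mem_ofPred_eq, hexp]
    constructor <;> intro h <;> linarith
  have hker : ∀ x w, x ∈ {z | qval Q (c - intVec z) = qval Q c} → b w w = 0 →
      x + w ∈ {z | qval Q (c - intVec z) = qval Q c} := fun x w hx hw => by
    rw [hmem] at hx ⊢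
    have h1 := hle w
    have h2 := hle (-w)
    have h3 := hb.apply_eq_zero hw x
    have h4 := hb.symm w x
    simp only [hlneg, map_neg, LinearMap.neg_apply, neg_neg] at h2
    simp only [hladd, map_add, LinearMap.add_apply]
    linarith
  constructor
  · intro hz
    obtain ⟨w, hw, hv⟩ := exists_parityMinimal_sub hb hp (v := z) fun w => by
      have h3 := (hmem z).mp hz
      have h4 := hb.symm w z
      have h1 := hle (z - w)
      have h2 := hle w
      simp only [sub_eq_add_neg, hladd, hlneg, map_add, map_neg, LinearMap.add_apply,
        LinearMap.neg_apply] at h1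
      linarith
    have hw2 : (-(2 : ℤ)) • w ∈ hb.kernel := hb.kernel.smul_mem _ hw
    have e : z - (2 : ℤ) • w = z + (-(2 : ℤ)) • w := by module
    refine ⟨z - (2 : ℤ) • w, ⟨e ▸ hker z _ hz hw2, hv⟩, ?_⟩
    rw [sub_sub_cancel]
    exact hb.kernel.smul_mem _ hw
  · rintro ⟨u, ⟨hu, -⟩, hzu⟩
    simpa using hker u _ hu hzu

/-! ### Fingerprints of invariant forms -/

/-- The columns of `V` are linearly independent parity minimal vectors of `Q` and `P`. -/
def IsAdapted (P Q : Matrix (Fin d) (Fin d) ℝ) (V : Matrix (Fin d) (Fin d) ℤ) : Prop :=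
  V.det ≠ 0 ∧ ∀ j, V.col j ∈ parityMinimal (latticeForm Q) (latticeForm P)

/-- The parity minimal vectors on which `Q` vanishes. -/
def kernelVectors (P Q : Matrix (Fin d) (Fin d) ℝ) : Set (Fin d → ℤ) :=
  {z | z ∈ parityMinimal (latticeForm Q) (latticeForm P) ∧ latticeForm Q z z = 0}

/-- The combinatorial data of `Q` and `G` in terms of an adapted matrix `V`: the determinant of `V`
and the residues of `V` modulo it, then the Cramer coordinates of the parity minimal vectors
in the kernel of `Q`, of those in each member of `nearestSets Q`, and, columnwise, of
the images of the columns of `V` under each `g ∈ G`. -/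
def fingerprint (G : Subgroup (GL (Fin d) ℤ)) (P Q : Matrix (Fin d) (Fin d) ℝ)
    (V : Matrix (Fin d) (Fin d) ℤ) :
    ℤ × (Fin d → Fin d → ℤ) × Set (Fin d → ℤ) × Set (Set (Fin d → ℤ)) ×
      Set (Fin d → Fin d → ℤ) :=
  (V.det, fun i j => V i j % V.det, V.cramer '' kernelVectors P Q,
    (fun W => V.cramer '' (W ∩ parityMinimal (latticeForm Q) (latticeForm P))) '' nearestSets Q,
    (fun (g : GL (Fin d) ℤ) j => V.cramer (g.1 *ᵥ V.col j)) '' G)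

theorem finite_fingerprint (G : Subgroup (GL (Fin d) ℤ)) {P : Matrix (Fin d) (Fin d) ℝ}
    (hP : P.PosDef) (hPG : ∀ g ∈ G, act g P = P) :
    {F | ∃ Q ∈ rationalClosure d, Q ∈ invariantForms G ∧
      ∃ V, IsAdapted P Q V ∧ F = fingerprint G P Q V}.Finite := by
  let K : ℤ := (d + 1) ^ d
  have hbox : (Set.Icc (fun _ => -K) (fun _ => K) : Set (Fin d → ℤ)).Finite := Set.finite_Icc _ _
  have hbox2 : (Set.Icc (fun _ _ => -K) (fun _ _ => K) : Set (Fin d → Fin d → ℤ)).Finite :=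
    Set.finite_Icc _ _
  refine ((Set.finite_Icc (-K) K).prod (hbox2.prod (hbox.powerset.prod
    (hbox.powerset.powerset.prod hbox2.powerset)))).subset ?_
  rintro _ ⟨Q, hQ, hQG, V, ⟨hV0, hV⟩, rfl⟩
  have hb := (isIntegralPullback_of_mem_rationalClosure hQ).isTame
  have hp := (isIntegralPullback_of_posDef hP).isTame
  have hpos : ∀ z, latticeForm P z z = 0 → z = 0 := fun z hz => by
    by_contra hne
    refine (hP.dotProduct_mulVec_pos (x := intVec z) fun h => hne ?_).ne' hz
    ext i
    simpa [intVec] using congrFun h i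
  have hdet : |V.det| ≤ K := abs_det_le hb hp hpos hV
  have hcr : ∀ x ∈ parityMinimal (latticeForm Q) (latticeForm P), ∀ i, -K ≤ V.cramer x i ∧
      V.cramer x i ≤ K := fun x hx i => abs_le.mp (abs_cramer_le hb hp hpos hV hx i)
  have hcr' : ∀ x ∈ parityMinimal (latticeForm Q) (latticeForm P),
      V.cramer x ∈ Set.Icc (fun _ => -K) (fun _ => K) := fun x hx =>
    ⟨fun i => (hcr x hx i).1, fun i => (hcr x hx i).2⟩
  have hmod : ∀ i j, 0 ≤ V i j % V.det ∧ V i j % V.det ≤ K := fun i j =>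
    ⟨Int.emod_nonneg _ hV0, (Int.emod_lt_abs _ hV0).le.trans hdet⟩
  have hK : 0 ≤ K := (abs_nonneg _).trans hdet
  refine ⟨abs_le.mp hdet, ⟨fun i j => (neg_nonpos.mpr hK).trans (hmod i j).1,
    fun i j => (hmod i j).2⟩, ?_, ?_, ?_⟩
  · rintro _ ⟨x, hx, rfl⟩
    exact hcr' x hx.1
  · rintro _ ⟨W, -, rfl⟩ _ ⟨x, hx, rfl⟩
    exact hcr' x hx.2
  · rintro _ ⟨g, hg, rfl⟩
    have hmem := fun j => mulVec_mem_parityMinimal (hQG.2 g hg) (hPG g hg) (hV j)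
    exact ⟨fun j i => (hcr _ (hmem j) i).1, fun j i => (hcr _ (hmem j) i).2⟩

/-! ### Comparison of forms with the same fingerprint -/

theorem cramer_injective {V : Matrix (Fin d) (Fin d) ℤ} (hV : V.det ≠ 0) :
    Function.Injective V.cramer := fun x y hxy => by
  have h := congrArg (V *ᵥ ·) hxy
  simp only [Matrix.mulVec_cramer] at h
  exact smul_right_injective _ hV h

theorem cramer_mulVec_of_mul_eq {V W : Matrix (Fin d) (Fin d) ℤ} (hdet : V.det = W.det)
    (hV : V.det ≠ 0) {h : Matrix (Fin d) (Fin d) ℤ} (hVW : h * V = W) (x : Fin d → ℤ) :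
    W.cramer (h *ᵥ x) = V.cramer x := by
  rw [← sub_eq_zero]
  refine Matrix.eq_zero_of_mulVec_eq_zero (hdet ▸ hV) ?_
  rw [Matrix.mulVec_sub, Matrix.mulVec_cramer, ← hVW, ← Matrix.mulVec_mulVec,
    Matrix.mulVec_cramer, hVW, hdet, Matrix.mulVec_smul, sub_self]

theorem mem_iff_of_image_cramer_eq {V W : Matrix (Fin d) (Fin d) ℤ} (hdet : V.det = W.det)
    (hV : V.det ≠ 0) {h : Matrix (Fin d) (Fin d) ℤ} (hVW : h * V = W) {A B : Set (Fin d → ℤ)}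
    (hAB : V.cramer '' A = W.cramer '' B) (x : Fin d → ℤ) : x ∈ A ↔ h *ᵥ x ∈ B := by
  rw [← (cramer_injective hV).mem_set_image, hAB, ← cramer_mulVec_of_mul_eq hdet hV hVW,
    (cramer_injective (hdet ▸ hV)).mem_set_image]

theorem mulVec_inv_mulVec (h : GL (Fin d) ℤ) (x : Fin d → ℤ) : h.1 *ᵥ ((h⁻¹).1 *ᵥ x) = x := by
  rw [Matrix.mulVec_mulVec, ← Units.val_mul, mul_inv_cancel, Units.val_one, Matrix.one_mulVec]

theorem latticeForm_mulVec_eq_zero {P Q₁ Q₂ : Matrix (Fin d) (Fin d) ℝ} (hP : P.PosDef)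
    (hQ₁ : IsIntegralPullback Q₁) (hQ₂ : IsIntegralPullback Q₂) {h : GL (Fin d) ℤ}
    (hker : ∀ x ∈ kernelVectors P Q₁, h.1 *ᵥ x ∈ kernelVectors P Q₂) {z : Fin d → ℤ}
    (hz : latticeForm Q₁ z z = 0) : latticeForm Q₂ (h.1 *ᵥ z) (h.1 *ᵥ z) = 0 := by
  have hp := (isIntegralPullback_of_posDef hP).isTame
  obtain ⟨r, hr, hmem⟩ := (mem_kernel_iff_exists_smul_mem_span hQ₁.isTame hp z).mp hz
  refine (mem_kernel_iff_exists_smul_mem_span hQ₂.isTame hp _).mpr ⟨r, hr, ?_⟩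
  have h1 := Submodule.mem_map_of_mem (f := h.1.mulVecLin) hmem
  rw [Submodule.map_span, map_smul] at h1
  refine Submodule.span_mono ?_ h1
  rintro _ ⟨x, hx, rfl⟩
  exact hker x hx

/-- Half of the comparison of nearest sets; the other half is the same statement for `h⁻¹`. -/
theorem preimage_inv_mem_nearestSets {P Q₁ Q₂ : Matrix (Fin d) (Fin d) ℝ} (hP : P.PosDef)
    (hQ₁ : IsIntegralPullback Q₁) (hQ₂ : IsIntegralPullback Q₂)
    {V W : Matrix (Fin d) (Fin d) ℤ} (hV : V.det ≠ 0) {h : GL (Fin d) ℤ}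
    (hVW : h.1 * V = W) (hdet : V.det = W.det)
    (hker : V.cramer '' kernelVectors P Q₁ = W.cramer '' kernelVectors P Q₂)
    (hnear : (fun A => V.cramer '' (A ∩ parityMinimal (latticeForm Q₁) (latticeForm P))) ''
        nearestSets Q₁ =
      (fun A => W.cramer '' (A ∩ parityMinimal (latticeForm Q₂) (latticeForm P))) ''
        nearestSets Q₂)
    {A : Set (Fin d → ℤ)} (hA : A ∈ nearestSets Q₁) :
    ((h⁻¹).1 *ᵥ ·) ⁻¹' A ∈ nearestSets Q₂ := by
  have hp := (isIntegralPullback_of_posDef hP).isTame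
  have hkv := mem_iff_of_image_cramer_eq hdet hV hVW hker
  obtain ⟨B, hB, hAB⟩ := hnear.subset ⟨A, hA, rfl⟩
  have hiff := mem_iff_of_image_cramer_eq hdet hV hVW hAB.symm
  convert hB
  ext y
  rw [Set.mem_preimage, mem_iff_of_mem_nearestSets hQ₁ hp hA, mem_iff_of_mem_nearestSets hQ₂ hp hB]
  constructor
  · rintro ⟨u, hu, h0⟩
    refine ⟨h.1 *ᵥ u, (hiff u).mp hu, ?_⟩
    have h1 := latticeForm_mulVec_eq_zero hP hQ₁ hQ₂ (fun x hx => (hkv x).mp hx) h0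
    rwa [Matrix.mulVec_sub, mulVec_inv_mulVec] at h1
  · rintro ⟨u, hu, h0⟩
    refine ⟨(h⁻¹).1 *ᵥ u, (hiff _).mpr (by rwa [mulVec_inv_mulVec]), ?_⟩
    rw [← Matrix.mulVec_sub]
    refine latticeForm_mulVec_eq_zero hP hQ₂ hQ₁ (fun x hx => ?_) h0
    rw [hkv, mulVec_inv_mulVec]
    exact hx

/-- Equal action parts of the fingerprint give `h⁻¹ G h ≤ G`, hence invariant forms go to
invariant forms. -/
theorem act_inv_mem_invariantForms {G : Subgroup (GL (Fin d) ℤ)}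
    {V W : Matrix (Fin d) (Fin d) ℤ} (hV : V.det ≠ 0) {h : GL (Fin d) ℤ}
    (hVW : h.1 * V = W) (hdet : V.det = W.det)
    (hG : (fun (g : GL (Fin d) ℤ) j => V.cramer (g.1 *ᵥ V.col j)) '' G =
      (fun (g : GL (Fin d) ℤ) j => W.cramer (g.1 *ᵥ W.col j)) '' G)
    {X : Matrix (Fin d) (Fin d) ℝ} (hX : X ∈ invariantForms G) :
    act h⁻¹ X ∈ invariantForms G := by
  refine ⟨isSymm_act hX.1 _, fun g' hg' => ?_⟩
  obtain ⟨g, hg, hgg'⟩ := hG.superset ⟨g', hg', rfl⟩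
  have hcol : ∀ j, W.col j = h.1 *ᵥ V.col j := fun j => by
    rw [← hVW]
    ext i
    simp [Matrix.mul_apply, Matrix.mulVec, dotProduct, Matrix.col_apply]
  have hmul : h.1 * g.1 * V = g'.1 * h.1 * V := by
    refine Matrix.ext_col fun j => ?_
    have h1 := congrFun hgg' j
    simp only at h1
    rw [← cramer_mulVec_of_mul_eq hdet hV hVW, hcol] at h1
    have h2 := cramer_injective (hdet ▸ hV) h1
    rw [Matrix.mulVec_mulVec, Matrix.mulVec_mulVec] at h2
    have hc : ∀ M : Matrix (Fin d) (Fin d) ℤ, (M * V).col j = M *ᵥ V.col j := fun M => by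
      ext i
      simp [Matrix.mul_apply, Matrix.mulVec, dotProduct, Matrix.col_apply]
    rw [hc, hc, h2]
  have hconj : h * g = g' * h := by
    refine Units.ext ?_
    have h1 := congrArg (· * V.adjugate) hmul
    simp only [Matrix.mul_assoc, Matrix.mul_adjugate, Matrix.mul_smul, Matrix.mul_one] at h1
    exact smul_right_injective _ hV h1
  have hconj' : h⁻¹ * g' = g * h⁻¹ := by
    rw [eq_mul_inv_iff_mul_eq, mul_assoc, ← hconj, inv_mul_cancel_left]
  rw [← act_mul, hconj', act_mul, hX.2 g hg]

theorem tEquivalent_of_fingerprint_eq {G : Subgroup (GL (Fin d) ℤ)}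
    {P Q₁ Q₂ : Matrix (Fin d) (Fin d) ℝ} (hP : P.PosDef)
    (hQ₁ : Q₁ ∈ rationalClosure d) (hQ₂ : Q₂ ∈ rationalClosure d)
    {V W : Matrix (Fin d) (Fin d) ℤ} (hV : V.det ≠ 0)
    (hF : fingerprint G P Q₁ V = fingerprint G P Q₂ W) :
    TEquivalent (invariantForms G) (secondaryCone (Del Q₁) ∩ invariantForms G)
      (secondaryCone (Del Q₂) ∩ invariantForms G) := by
  simp only [fingerprint, Prod.mk.injEq] at hF
  obtain ⟨hdet, hmod, hker, hnear, hG⟩ := hF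
  have hW : W.det ≠ 0 := hdet ▸ hV
  obtain ⟨h, hVW⟩ := exists_mul_eq_of_emod_det hdet hV fun i j => by
    have := congrFun (congrFun hmod i) j
    rwa [← hdet] at this
  have hWV : (h⁻¹).1 * W = V := by
    rw [← hVW, ← Matrix.mul_assoc, ← Units.val_mul, inv_mul_cancel, Units.val_one, Matrix.one_mul]
  have hI₁ := isIntegralPullback_of_mem_rationalClosure hQ₁
  have hI₂ := isIntegralPullback_of_mem_rationalClosure hQ₂
  have hpre : ∀ (g : GL (Fin d) ℤ) (A : Set (Fin d → ℤ)),
      ((g⁻¹).1 *ᵥ ·) ⁻¹' ((g.1 *ᵥ ·) ⁻¹' A) = A := fun g A => by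
    ext x
    simp only [Set.mem_preimage, mulVec_inv_mulVec]
  have hDel : Del (act h⁻¹ Q₁) = Del Q₂ := by
    refine Del_eq_of_nearestSets_eq (isIntegralPullback_of_mem_rationalClosure
      (act_mem_rationalClosure hQ₁ _)).qval_nonneg hI₂.qval_nonneg
      (Set.Subset.antisymm (fun A hA => ?_) fun A hA => ?_)
    · have h1 := preimage_mem_nearestSets_act h hA
      rw [act_act_inv] at h1
      have h2 := preimage_inv_mem_nearestSets hP hI₁ hI₂ hV hVW hdet hker hnear h1
      rwa [hpre] at h2
    · have h1 := preimage_inv_mem_nearestSets hP hI₂ hI₁ hW hWV hdet.symm hker.symm hnear.symm hA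
      rw [inv_inv] at h1
      have h2 := preimage_mem_nearestSets_act h⁻¹ h1
      rwa [hpre] at h2
  have hT : ∀ X ∈ invariantForms G, act h⁻¹ X ∈ invariantForms G := fun X hX =>
    act_inv_mem_invariantForms hV hVW hdet hG hX
  have hT' : ∀ X ∈ invariantForms G, act h X ∈ invariantForms G := fun X hX => by
    have := act_inv_mem_invariantForms hW hWV hdet.symm hG.symm hX
    rwa [inv_inv] at this
  have hDel' : Del (act h Q₂) = Del Q₁ := by
    rw [Del_act_eq hDel.symm h, act_act_inv]
  refine ⟨h⁻¹, Set.Subset.antisymm ?_ fun X hX => ?_, Set.Subset.antisymm ?_ fun X hX => ?_⟩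
  · rintro _ ⟨X, ⟨⟨hX, hXD⟩, hXT⟩, rfl⟩
    exact ⟨⟨act_mem_rationalClosure hX _, (Del_act_eq hXD _).trans hDel⟩, hT X hXT⟩
  · exact ⟨act h X, ⟨⟨act_mem_rationalClosure hX.1.1 _, (Del_act_eq hX.1.2 _).trans hDel'⟩,
      hT' X hX.2⟩, act_inv_act h X⟩
  · rintro _ ⟨X, hX, rfl⟩
    exact hT X hX
  · exact ⟨act h X, hT' X hX, act_inv_act h X⟩

end Voronoi

open Voronoi in
theorem corollary4p2 (d : ℕ) (G : Subgroup (GL (Fin d) ℤ)) (hG : Finite G) :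
    Finite (Quotient (Voronoi.tSetoid (Voronoi.invariantForms G))) := by
  obtain ⟨P, hP, hPG⟩ := exists_posDef_invariant G
  have hfin := finite_fingerprint G hP hPG
  -- `none` is the label of the empty cone, which arises from a subdivision all of whose forms are non-invariant
  have hlabel : ∀ C : tSecondaryCones (invariantForms G),
      ∃ F ∈ insert none (some '' {F | ∃ Q ∈ rationalClosure d, Q ∈ invariantForms G ∧
        ∃ V, IsAdapted P Q V ∧ F = fingerprint G P Q V}),
      (F = none ∧ C.1 = ∅) ∨ ∃ Q ∈ rationalClosure d, ∃ V : Matrix (Fin d) (Fin d) ℤ,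
        V.det ≠ 0 ∧ F = some (fingerprint G P Q V) ∧
          C.1 = secondaryCone (Del Q) ∩ invariantForms G := by
    rintro ⟨_, D, -, rfl⟩
    rcases (secondaryCone D ∩ invariantForms G : Set _).eq_empty_or_nonempty with h | h
    · exact ⟨none, Set.mem_insert _ _, Or.inl ⟨rfl, h⟩⟩
    · obtain ⟨Q, ⟨hQ, rfl⟩, hQG⟩ := h
      obtain ⟨V, hV⟩ := exists_det_ne_zero (isIntegralPullback_of_mem_rationalClosure hQ).isTame
        (isIntegralPullback_of_posDef hP).isTame
      exact ⟨_, Set.mem_insert_of_mem _ ⟨_, ⟨Q, hQ, hQG, V, hV, rfl⟩, rfl⟩,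
        Or.inr ⟨Q, hQ, V, hV.1, rfl, rfl⟩⟩
  choose F hF hFC using hlabel
  have := ((hfin.image some).insert none).to_subtype
  refine Finite.of_injective (fun q : Quotient (tSetoid (invariantForms G)) =>
    (⟨F q.out, hF q.out⟩ : (insert none (some '' {F | ∃ Q ∈ rationalClosure d,
      Q ∈ invariantForms G ∧ ∃ V, IsAdapted P Q V ∧ F = fingerprint G P Q V}) : Set _)))
    fun q q' hqq' => ?_
  have hFF : F q.out = F q'.out := congrArg Subtype.val hqq'
  rw [← Quotient.out_equiv_out]
  change TEquivalent _ q.out.1 q'.out.1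
  rcases hFC q.out with ⟨h1, hC⟩ | ⟨Q, hQ, V, hV, h1, hC⟩ <;>
    rcases hFC q'.out with ⟨h1', hC'⟩ | ⟨Q', hQ', V', hV', h1', hC'⟩ <;>
    rw [h1, h1'] at hFF
  · rw [hC, hC']
    exact (tEquivalent_equivalence _).refl _
  · cases hFF
  · cases hFF
  · rw [hC, hC']
    exact tEquivalent_of_fingerprint_eq hP hQ hQ' hV (Option.some.inj hFF)
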